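/- Let $d\ge 2$, let $\{|m_x\rangle\}_{x=1}^d$ be an orthonormal basis of $\mathbb C^d$ with rank-one projective measurement $\mathcal M=\{|m_x\rangle\langle m_x|\}_x$, and let $|\phi\rangle\in\mathbb C^d$ be a unit vector unbiased to it, i.e. $|\langle m_x|\phi\rangle|^2=1/d$ for all $x$. Let $\Delta_\varepsilon(X)=(1-\varepsilon)X+\frac{\varepsilon}{d}\operatorname{tr}(X)\,\mathbb 1$ be the depolarizing channel, let $0<\varepsilon<1$ and $\delta=\varepsilon(2-\varepsilon)$, and put $\rho_\varepsilon=\Delta_\varepsilon(|\phi\rangle\langle\phi|)$, $\rho_\delta=\Delta_\delta(|\phi\rangle\langle\phi|)$, $M_{x,\varepsilon}=\Delta_\varepsilon(|m_x\rangle\langle m_x|)$. A strategy of the single eavesdropper is a decomposition $\rho_\delta=\sum_{\mu=0}^{d}p_\mu\rho_\mu$ into density operators $\rho_\mu$ with probabilities $p_\mu$; she guesses $j$ when $\rho_j$ ($1\le j\le d$) is sent and is inconclusive when $\rho_0$ is sent, so that $P_{\rm guess}=\sum_{j=1}^d p_j\langle m_j|\rho_j|m_j\rangle$ and $P_{\rm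 inc}=p_0$. A strategy of the joint eavesdropper consists of finitely many unit vectors $|\psi_\mu\rangle\in\mathbb C^d$ and POVMs $\{N_{x,\nu}\}_{x=1}^d$ on $\mathbb C^d$, a joint probability distribution $p_{\mu,\nu}$, and a guessing function $f(\mu,\nu)\in\{0,1,\dots,d\}$ ($0$ meaning inconclusive), such that, for all $x$, $\sum_{\mu,\nu}p_{\mu,\nu}|\psi_\mu\rangle\langle\psi_\mu|=\rho_\varepsilon$, $\sum_{\mu,\nu}p_{\mu,\nu}N_{x,\nu}=M_{x,\varepsilon}$ and $\sum_{\mu,\nu}p_{\mu,\nu}\langle\psi_\mu|N_{x,\nu}|\psi_\mu\rangle=\operatorname{tr}(\rho_\varepsilon M_{x,\varepsilon})$; here $P_{\rm guess}=\sum_{f(\mu,\nu)\neq 0}p_{\mu,\nu}\langle\psi_\mu|N_{f(\mu,\nu),\nu}|\psi_\mu\rangle$ and $P_{\rm inc}=\sum_{f(\mu,\nu)=0}p_{\mu,\nu}$. In both cases the probability of error is $P_{\rm err}=1-P_{\rm inc}-P_{\rm guess}$. For $T\ge 0$ let $P_{\rm single}(T)$ and $P_{\rm joint}(T)$ be the suprema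 of $P_{\rm guess}$ over the respective strategies with $P_{\rm err}\le T$. Then $P_{\rm joint}(T)>P_{\rm single}(T)$ for every $T\ge 0$. Moreover, if $\varepsilon\ge\varepsilon_{\rm crit}=\frac{d}{2(d+\sqrt d)}$, then for every $T\ge 0$ the maximum of $P_{\rm guess}$ over the joint strategies with $P_{\rm err}\le T$ is attained and equals $1$. -/

import Mathlib

open scoped Matrix ComplexOrder

noncomputable section

namespace SharedNoise

/-- The operator `|v⟩⟨v|`, as a matrix in the computational basis of `ℂ^d`. -/
def ketbra {d : ℕ} (v : EuclideanSpace ℂ (Fin d)) : Matrix (Fin d) (Fin d) ℂ :=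
  Matrix.vecMulVec v.ofLp (star v.ofLp)

/-- Density operators on `ℂ^d`. -/
structure IsState {d : ℕ} (ρ : Matrix (Fin d) (Fin d) ℂ) : Prop where
  posSemidef : ρ.PosSemidef
  trace_eq_one : ρ.trace = 1

/-- POVMs on `ℂ^d` with `d` outcomes. -/
structure IsPOVM {d : ℕ} (M : Fin d → Matrix (Fin d) (Fin d) ℂ) : Prop where
  posSemidef : ∀ x, (M x).PosSemidef
  sum_eq_one : ∑ x, M x = 1

/-- The Born rule: the probability `tr (ρ E)` of the effect `E` on the state `ρ`. -/
def born {d : ℕ} (ρ E : Matrix (Fin d) (Fin d) ℂ) : ℝ := (ρ * E).trace.re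

/-- The depolarizing channel `X ↦ (1 - ε) X + ε (tr X) 𝟙 / d`. On operators of trace one this is
`(1 - ε) X + (ε / d) 𝟙`. -/
def depolarize {d : ℕ} (ε : ℝ) (X : Matrix (Fin d) (Fin d) ℂ) : Matrix (Fin d) (Fin d) ℂ :=
  (1 - ε) • X + ((ε / d : ℝ) : ℂ) • X.trace • (1 : Matrix (Fin d) (Fin d) ℂ)

/-- The rank-one projective measurement in the orthonormal basis `m`. -/
def basisMeasurement {d : ℕ} (m : OrthonormalBasis (Fin d) ℂ (EuclideanSpace ℂ (Fin d))) :
    Fin d → Matrix (Fin d) (Fin d) ℂ :=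
  fun x => ketbra (m x)

/-- The basis `m` is unbiased to the vector `φ`: `|⟨m_j|φ⟩|² = 1/d` for all `j`. -/
def IsUnbiased {d : ℕ} (m : OrthonormalBasis (Fin d) ℂ (EuclideanSpace ℂ (Fin d)))
    (φ : EuclideanSpace ℂ (Fin d)) : Prop :=
  ∀ j, ‖inner ℂ (m j) φ‖ ^ 2 = 1 / (d : ℝ)

/-- A strategy of an eavesdropper correlated to the state only: a decomposition
`ρ = ∑ μ, p_μ ρ_μ` of the state. When `ρ_j` with `μ = some j` is sent, she guesses `j`; when the
state with `μ = none` is sent, she returns the inconclusive outcome. -/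
structure SingleStrategy {d : ℕ} (ρ : Matrix (Fin d) (Fin d) ℂ) where
  /-- the probability of each state -/
  p : Option (Fin d) → ℝ
  /-- the states of the decomposition -/
  σ : Option (Fin d) → Matrix (Fin d) (Fin d) ℂ
  p_nonneg : ∀ μ, 0 ≤ p μ
  p_sum : ∑ μ, p μ = 1
  isState : ∀ μ, IsState (σ μ)
  state_eq : ∑ μ, p μ • σ μ = ρ

namespace SingleStrategy

variable {d : ℕ} {ρ : Matrix (Fin d) (Fin d) ℂ}

/-- The probability of a correct guess of the outcome of the measurement `M`. -/
def guess (S : SingleStrategy ρ) (M : Fin d → Matrix (Fin d) (Fin d) ℂ) : ℝ :=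
  ∑ j, S.p (some j) * born (S.σ (some j)) (M j)

/-- The probability of an inconclusive outcome. -/
def inconclusive (S : SingleStrategy ρ) : ℝ := S.p none

/-- The probability of a wrong guess of the outcome of the measurement `M`. -/
def error (S : SingleStrategy ρ) (M : Fin d → Matrix (Fin d) (Fin d) ℂ) : ℝ :=
  1 - S.inconclusive - S.guess M

end SingleStrategy

/-- A strategy of an eavesdropper jointly correlated to the state `ρ` and the measurement `M`:
pure states `ψ_μ` and POVMs `N_ν` are sent with joint probability `p_{μ,ν}`, reproducing on average
the state, the measurement and the outcome statistics; she then guesses `f(μ, ν)`, where `none` is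
the inconclusive outcome. -/
structure JointStrategy {d : ℕ} (ρ : Matrix (Fin d) (Fin d) ℂ)
    (M : Fin d → Matrix (Fin d) (Fin d) ℂ) where
  /-- the number of states -/
  k : ℕ
  /-- the number of POVMs -/
  l : ℕ
  /-- the joint probability distribution -/
  p : Fin k → Fin l → ℝ
  /-- the pure states -/
  ψ : Fin k → EuclideanSpace ℂ (Fin d)
  /-- the POVMs: `N ν x` is the element of `N_ν` for the outcome `x` -/
  N : Fin l → Fin d → Matrix (Fin d) (Fin d) ℂ
  /-- the guessing function -/
  f : Fin k → Fin l → Option (Fin d)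
  p_nonneg : ∀ μ ν, 0 ≤ p μ ν
  p_sum : ∑ μ, ∑ ν, p μ ν = 1
  norm_ψ : ∀ μ, ‖ψ μ‖ = 1
  isPOVM : ∀ ν, IsPOVM (N ν)
  state_eq : ∑ μ, ∑ ν, p μ ν • ketbra (ψ μ) = ρ
  meas_eq : ∀ x, ∑ μ, ∑ ν, p μ ν • N ν x = M x
  born_eq : ∀ x, ∑ μ, ∑ ν, p μ ν * born (ketbra (ψ μ)) (N ν x) = born ρ (M x)

namespace JointStrategy

variable {d : ℕ} {ρ : Matrix (Fin d) (Fin d) ℂ} {M : Fin d → Matrix (Fin d) (Fin d) ℂ}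

/-- The conditional probability `p(y | μ, ν)` of the outcome `y`; the inconclusive `none` is never
an outcome. -/
def cond (S : JointStrategy ρ M) (μ : Fin S.k) (ν : Fin S.l) : Option (Fin d) → ℝ
  | none => 0
  | some x => born (ketbra (S.ψ μ)) (S.N ν x)

/-- The probability of a correct guess. -/
def guess (S : JointStrategy ρ M) : ℝ := ∑ μ, ∑ ν, S.p μ ν * S.cond μ ν (S.f μ ν)

/-- The probability of an inconclusive outcome. -/
def inconclusive (S : JointStrategy ρ M) : ℝ :=
  ∑ μ, ∑ ν, if S.f μ ν = none then S.p μ ν else 0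

/-- The probability of a wrong guess. -/
def error (S : JointStrategy ρ M) : ℝ := 1 - S.inconclusive - S.guess

end JointStrategy

/-- The guessing probabilities that an eavesdropper correlated to the state `ρ` only can achieve
for the measurement `M` with a probability of error at most `T`. -/
def singleGuesses {d : ℕ} (ρ : Matrix (Fin d) (Fin d) ℂ) (M : Fin d → Matrix (Fin d) (Fin d) ℂ)
    (T : ℝ) : Set ℝ :=
  {g | ∃ S : SingleStrategy ρ, S.error M ≤ T ∧ S.guess M = g}

/-- The guessing probabilities that an eavesdropper jointly correlated to the state `ρ` and the
measurement `M` can achieve with a probability of error at most `T`. -/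
def jointGuesses {d : ℕ} (ρ : Matrix (Fin d) (Fin d) ℂ) (M : Fin d → Matrix (Fin d) (Fin d) ℂ)
    (T : ℝ) : Set ℝ :=
  {g | ∃ S : JointStrategy ρ M, S.error ≤ T ∧ S.guess = g}

/-- The optimal guessing probability of the single eavesdropper, given error at most `T`. -/
def singleGuessProb {d : ℕ} (ρ : Matrix (Fin d) (Fin d) ℂ)
    (M : Fin d → Matrix (Fin d) (Fin d) ℂ) (T : ℝ) : ℝ :=
  sSup (singleGuesses ρ M T)

/-- The optimal guessing probability of the joint eavesdropper, given error at most `T`. -/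
def jointGuessProb {d : ℕ} (ρ : Matrix (Fin d) (Fin d) ℂ)
    (M : Fin d → Matrix (Fin d) (Fin d) ℂ) (T : ℝ) : ℝ :=
  sSup (jointGuesses ρ M T)

/-- The critical noise `d / (2 (d + √d))`. -/
def critNoise (d : ℕ) : ℝ := d / (2 * (d + √(d : ℝ)))

end SharedNoise

end

/-! After rephasing the basis, `φ` is the normalized sum of vectors `e x`, and each strategy of the
single eavesdropper reduces to two amplitudes: `G ^ 2` is her guessing probability and `(d - 1) * h
^ 2` her error. Testing the decomposition against `∑ x, e x` and applying Cauchy–Schwarz twice gives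
`(G - h) ^ 2 ≤ δ` (`SingleStrategy.sq_sub_le_noise`).

The joint eavesdropper reaches the same guessing and inconclusive probabilities by tilting the state
half of the time and the measurement the other half. The noise is thereby shared: each side carries
`(G - h) ^ 2 / 2 ≤ δ / 2 = ε - ε ^ 2 / 2` (`noisyRealizes_of_sq_add_eq`). The missing noise, at
least `ε ^ 2 / 2`, is supplied by an ensemble of noise one whose outcome is known. This raises the
guessing probability without raising the error. Since `δ < 1` keeps the single guess away from one
(`guess_le_of_sq_sub_le`), the gain has a positive lower bound common to all strategies, so the
suprema differ strictly.

If state and measurement carry the same tilt, every guess is right. The two noises then agree at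
`critNoise d` (`noisyRealizes_critNoise`), and larger noise is reached by mixing in the same trivial
ensemble.

All ensembles used have uniform outcome statistics, as do the noisy state and measurement, so the
constraint on the statistics survives mixing. -/

namespace SharedNoise

variable {d : ℕ}

/-! ### Rank-one operators. -/

/-- The operator `|v⟩⟨w|`. -/
def outer (v w : EuclideanSpace ℂ (Fin d)) : Matrix (Fin d) (Fin d) ℂ :=
  Matrix.vecMulVec v.ofLp (star w.ofLp)

lemma ketbra_eq_outer (v : EuclideanSpace ℂ (Fin d)) : ketbra v = outer v v := rfl

lemma outer_add_left (u v w : EuclideanSpace ℂ (Fin d)) :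
    outer (u + v) w = outer u w + outer v w := by
  simp [outer, Matrix.add_vecMulVec]

lemma outer_add_right (u v w : EuclideanSpace ℂ (Fin d)) :
    outer u (v + w) = outer u v + outer u w := by
  simp [outer, Matrix.vecMulVec_add]

lemma outer_sub_left (u v w : EuclideanSpace ℂ (Fin d)) :
    outer (u - v) w = outer u w - outer v w := by
  simp [outer, Matrix.sub_vecMulVec]

lemma outer_sub_right (u v w : EuclideanSpace ℂ (Fin d)) :
    outer u (v - w) = outer u v - outer u w := by
  simp [outer, Matrix.vecMulVec_sub]

lemma outer_smul_left (r : ℝ) (v w : EuclideanSpace ℂ (Fin d)) :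
    outer (r • v) w = r • outer v w := by
  simp [outer, Matrix.smul_vecMulVec]

lemma outer_smul_right (r : ℝ) (v w : EuclideanSpace ℂ (Fin d)) :
    outer v (r • w) = r • outer v w := by
  simp [outer, Matrix.vecMulVec_smul]

lemma outer_sum_left {ι : Type*} (s : Finset ι) (v : ι → EuclideanSpace ℂ (Fin d))
    (w : EuclideanSpace ℂ (Fin d)) : outer (∑ i ∈ s, v i) w = ∑ i ∈ s, outer (v i) w := by
  induction s using Finset.cons_induction with
  | empty => simp [outer]
  | cons a s ha ih => rw [Finset.sum_cons, Finset.sum_cons, outer_add_left, ih]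

lemma outer_sum_right {ι : Type*} (s : Finset ι) (v : ι → EuclideanSpace ℂ (Fin d))
    (w : EuclideanSpace ℂ (Fin d)) : outer w (∑ i ∈ s, v i) = ∑ i ∈ s, outer w (v i) := by
  induction s using Finset.cons_induction with
  | empty => simp [outer]
  | cons a s ha ih => rw [Finset.sum_cons, Finset.sum_cons, outer_add_right, ih]

lemma ketbra_posSemidef (v : EuclideanSpace ℂ (Fin d)) : (ketbra v).PosSemidef :=
  Matrix.posSemidef_vecMulVec_self_star _

lemma trace_ketbra (v : EuclideanSpace ℂ (Fin d)) : (ketbra v).trace = ((‖v‖ ^ 2 : ℝ) : ℂ) := by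
  rw [ketbra, Matrix.trace_vecMulVec, ← EuclideanSpace.inner_eq_star_dotProduct,
    inner_self_eq_norm_sq_to_K]
  simp

lemma ketbra_smul_of_norm_eq_one {c : ℂ} (hc : ‖c‖ = 1) (v : EuclideanSpace ℂ (Fin d)) :
    ketbra (c • v) = ketbra v := by
  have h : c * star c = 1 := by
    have := RCLike.mul_conj c
    rw [hc] at this
    simpa using this
  rw [ketbra, WithLp.ofLp_smul, star_smul, Matrix.smul_vecMulVec, Matrix.vecMulVec_smul, smul_smul,
    h, one_smul, ketbra]

lemma sum_ketbra_orthonormalBasis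
    (m : OrthonormalBasis (Fin d) ℂ (EuclideanSpace ℂ (Fin d))) : ∑ x, ketbra (m x) = 1 := by
  ext i j
  have h := m.sum_repr' (EuclideanSpace.single j (1 : ℂ))
  have h2 := congrArg (fun v : EuclideanSpace ℂ (Fin d) => v i) h
  simp [EuclideanSpace.inner_single_right] at h2
  rw [Matrix.sum_apply, Matrix.one_apply]
  simp only [ketbra, Matrix.vecMulVec_apply, Pi.star_apply, RCLike.star_def]
  rw [← h2]
  exact Finset.sum_congr rfl fun x _ => mul_comm _ _

/-! ### The Born rule -/

lemma born_add_right (ρ A B : Matrix (Fin d) (Fin d) ℂ) :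
    born ρ (A + B) = born ρ A + born ρ B := by simp [born, mul_add]

lemma born_sum_right {ι : Type*} (s : Finset ι) (ρ : Matrix (Fin d) (Fin d) ℂ)
    (A : ι → Matrix (Fin d) (Fin d) ℂ) : born ρ (∑ i ∈ s, A i) = ∑ i ∈ s, born ρ (A i) := by
  simp [born, Finset.mul_sum, Matrix.trace_sum]

lemma born_smul_right (r : ℝ) (ρ A : Matrix (Fin d) (Fin d) ℂ) :
    born ρ (r • A) = r * born ρ A := by simp [born]

lemma born_add_left (ρ σ A : Matrix (Fin d) (Fin d) ℂ) :
    born (ρ + σ) A = born ρ A + born σ A := by simp [born, add_mul]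

lemma born_sum_left {ι : Type*} (s : Finset ι) (ρ : ι → Matrix (Fin d) (Fin d) ℂ)
    (A : Matrix (Fin d) (Fin d) ℂ) : born (∑ i ∈ s, ρ i) A = ∑ i ∈ s, born (ρ i) A := by
  simp [born, Finset.sum_mul, Matrix.trace_sum]

lemma born_smul_left (r : ℝ) (ρ A : Matrix (Fin d) (Fin d) ℂ) :
    born (r • ρ) A = r * born ρ A := by simp [born]

lemma born_one_right (ρ : Matrix (Fin d) (Fin d) ℂ) : born ρ 1 = ρ.trace.re := by simp [born]

lemma born_comm (ρ A : Matrix (Fin d) (Fin d) ℂ) : born ρ A = born A ρ := by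
  rw [born, Matrix.trace_mul_comm, born]

/-- For `ρ = Bᴴ B` the Born probability of `|v⟩⟨v|` is `‖B v‖²`. -/
lemma born_conjTranspose_mul_self (B : Matrix (Fin d) (Fin d) ℂ)
    (v : EuclideanSpace ℂ (Fin d)) :
    born (Bᴴ * B) (ketbra v) = ‖Matrix.toEuclideanLin B v‖ ^ 2 := by
  have h : (Bᴴ * B * ketbra v).trace = inner ℂ (Matrix.toEuclideanLin B v)
      (Matrix.toEuclideanLin B v) := by
    rw [EuclideanSpace.inner_eq_star_dotProduct, ketbra, Matrix.mul_vecMulVec,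
      Matrix.trace_vecMulVec, ← Matrix.mulVec_mulVec]
    simp only [Matrix.toLpLin_apply]
    rw [Matrix.star_mulVec, dotProduct_comm, Matrix.dotProduct_mulVec, dotProduct_comm]
  rw [born, h, inner_self_eq_norm_sq_to_K]
  norm_cast

open scoped MatrixOrder in
lemma exists_eq_conjTranspose_mul_self {A : Matrix (Fin d) (Fin d) ℂ} (hA : A.PosSemidef) :
    ∃ B : Matrix (Fin d) (Fin d) ℂ, A = Bᴴ * B :=
  CStarAlgebra.nonneg_iff_eq_star_mul_self.1 hA.nonneg

lemma born_nonneg {ρ A : Matrix (Fin d) (Fin d) ℂ} (hρ : ρ.PosSemidef) (hA : A.PosSemidef) :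
    0 ≤ born ρ A := by
  obtain ⟨B, rfl⟩ := exists_eq_conjTranspose_mul_self hρ
  have h := (hA.mul_mul_conjTranspose_same B).trace_nonneg
  rw [Matrix.trace_mul_comm, ← mul_assoc] at h
  exact (Complex.le_def.1 h).1

lemma born_ketbra_ketbra (v w : EuclideanSpace ℂ (Fin d)) :
    born (ketbra v) (ketbra w) = ‖inner ℂ v w‖ ^ 2 := by
  have h : (ketbra v * ketbra w).trace = inner ℂ v w * inner ℂ w v := by
    rw [ketbra, ketbra, Matrix.vecMulVec_mul_vecMulVec, Matrix.vecMulVec_smul, Matrix.trace_smul,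
      Matrix.trace_vecMulVec, EuclideanSpace.inner_eq_star_dotProduct,
      EuclideanSpace.inner_eq_star_dotProduct, smul_eq_mul, dotProduct_comm (star v.ofLp)]
  rw [born, h, ← inner_conj_symm w v, RCLike.mul_conj]
  norm_cast

lemma depolarize_ketbra (η : ℝ) {v : EuclideanSpace ℂ (Fin d)} (hv : ‖v‖ = 1) :
    depolarize η (ketbra v) = (1 - η) • ketbra v + (η / d) • 1 := by
  rw [depolarize, trace_ketbra, hv, Complex.coe_smul]
  simp

end SharedNoise

namespace SharedNoise

variable {d : ℕ}

/-! ### The single eavesdropper -/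

lemma born_state_sum_eq_one {σ : Matrix (Fin d) (Fin d) ℂ} (hσ : IsState σ)
    {e : Fin d → EuclideanSpace ℂ (Fin d)} (he : ∑ x, ketbra (e x) = 1) :
    ∑ x, born σ (ketbra (e x)) = 1 := by
  rw [← born_sum_right, he, born_one_right, hσ.trace_eq_one, Complex.one_re]

lemma born_state_le_one {σ : Matrix (Fin d) (Fin d) ℂ} (hσ : IsState σ)
    {e : Fin d → EuclideanSpace ℂ (Fin d)} (he : ∑ x, ketbra (e x) = 1) (j : Fin d) :
    born σ (ketbra (e j)) ≤ 1 := by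
  rw [← born_state_sum_eq_one hσ he]
  exact Finset.single_le_sum (f := fun x => born σ (ketbra (e x)))
    (fun x _ => born_nonneg hσ.posSemidef (ketbra_posSemidef _)) (Finset.mem_univ j)

/-- The uncertainty relation between a basis vector and a vector unbiased to the basis. -/
lemma born_sum_le {σ : Matrix (Fin d) (Fin d) ℂ} (hσ : IsState σ)
    {e : Fin d → EuclideanSpace ℂ (Fin d)} (he : ∑ x, ketbra (e x) = 1) (j : Fin d) :
    born σ (ketbra (∑ x, e x)) ≤
      (√(born σ (ketbra (e j))) + √((d : ℝ) - 1) * √(1 - born σ (ketbra (e j)))) ^ 2 := by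
  have hd : 0 < d := j.pos
  have hd1 : (0 : ℝ) ≤ d - 1 := by
    have : (1 : ℝ) ≤ d := by exact_mod_cast hd
    linarith
  have hsum := born_state_sum_eq_one hσ he
  obtain ⟨B, hB⟩ := exists_eq_conjTranspose_mul_self hσ.posSemidef
  have hb : ∀ v, born σ (ketbra v) = ‖Matrix.toEuclideanLin B v‖ ^ 2 := fun v => by
    rw [hB, born_conjTranspose_mul_self]
  simp only [hb] at hsum ⊢
  rw [map_sum, Real.sqrt_sq (norm_nonneg _)]
  have hrest : 1 - ‖Matrix.toEuclideanLin B (e j)‖ ^ 2 =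
      ∑ x ∈ Finset.univ.erase j, ‖Matrix.toEuclideanLin B (e x)‖ ^ 2 := by
    rw [Finset.sum_erase_eq_sub (Finset.mem_univ j), hsum]
  -- Cauchy–Schwarz is applied only to the `d - 1` vectors other than `e j`; the vector `e j` is
  -- split off by the triangle inequality.
  have hcs : ∑ x ∈ Finset.univ.erase j, ‖Matrix.toEuclideanLin B (e x)‖ ≤
      √((d : ℝ) - 1) * √(1 - ‖Matrix.toEuclideanLin B (e j)‖ ^ 2) := by
    rw [← Real.sqrt_mul hd1]
    apply Real.le_sqrt_of_sq_le
    rw [hrest]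
    have := sq_sum_le_card_mul_sum_sq (s := Finset.univ.erase j)
      (f := fun x => ‖Matrix.toEuclideanLin B (e x)‖)
    rwa [Finset.card_erase_of_mem (Finset.mem_univ j), Finset.card_univ, Fintype.card_fin,
      Nat.cast_sub hd, Nat.cast_one] at this
  refine pow_le_pow_left₀ (norm_nonneg _) ((norm_sum_le _ _).trans ?_) 2
  rw [← Finset.add_sum_erase _ _ (Finset.mem_univ j)]
  gcongr

/-- With no outcome singled out, Cauchy–Schwarz runs over all `d` vectors. This bounds the
contribution of the inconclusive state, about which nothing else is known. -/
lemma born_sum_le_card {σ : Matrix (Fin d) (Fin d) ℂ} (hσ : IsState σ)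
    {e : Fin d → EuclideanSpace ℂ (Fin d)} (he : ∑ x, ketbra (e x) = 1) :
    born σ (ketbra (∑ x, e x)) ≤ d := by
  have hsum := born_state_sum_eq_one hσ he
  obtain ⟨B, hB⟩ := exists_eq_conjTranspose_mul_self hσ.posSemidef
  have hb : ∀ v, born σ (ketbra v) = ‖Matrix.toEuclideanLin B v‖ ^ 2 := fun v => by
    rw [hB, born_conjTranspose_mul_self]
  simp only [hb] at hsum ⊢
  rw [map_sum]
  calc _ ≤ (∑ x, ‖Matrix.toEuclideanLin B (e x)‖) ^ 2 :=
        pow_le_pow_left₀ (norm_nonneg _) (norm_sum_le _ _) 2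
    _ ≤ _ := by
        simpa [hsum] using sq_sum_le_card_mul_sum_sq (s := Finset.univ)
          (f := fun x => ‖Matrix.toEuclideanLin B (e x)‖)

namespace SingleStrategy

variable {ρ : Matrix (Fin d) (Fin d) ℂ} {e : Fin d → EuclideanSpace ℂ (Fin d)}

lemma sum_p_some (S : SingleStrategy ρ) : ∑ j, S.p (some j) = 1 - S.p none := by
  have := S.p_sum
  rw [Fintype.sum_option] at this
  linarith

lemma guess_nonneg (S : SingleStrategy ρ) : 0 ≤ S.guess (fun x => ketbra (e x)) :=
  Finset.sum_nonneg fun _ _ => mul_nonneg (S.p_nonneg _)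
    (born_nonneg (S.isState _).posSemidef (ketbra_posSemidef _))

lemma sub_guess_eq (S : SingleStrategy ρ) :
    1 - S.p none - S.guess (fun x => ketbra (e x)) =
      ∑ j, S.p (some j) * (1 - born (S.σ (some j)) (ketbra (e j))) := by
  simp only [mul_sub, mul_one, Finset.sum_sub_distrib, sum_p_some, guess]

lemma guess_le (S : SingleStrategy ρ) (he : ∑ x, ketbra (e x) = 1) :
    S.guess (fun x => ketbra (e x)) ≤ 1 - S.p none := by
  rw [← sub_nonneg, sub_guess_eq]
  exact Finset.sum_nonneg fun j _ => mul_nonneg (S.p_nonneg _)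
    (sub_nonneg.2 (born_state_le_one (S.isState _) he j))

/-- The uncertainty relation is averaged over the conclusive states. After expanding the square only
the cross term is not affine in `b j`, and a second Cauchy–Schwarz, with weights `p j`, brings it to
the averaged quantities. -/
lemma born_sum_le (S : SingleStrategy ρ) (hd : 2 ≤ d) (he : ∑ x, ketbra (e x) = 1) :
    born ρ (ketbra (∑ x, e x)) ≤ S.p none * d +
      (√(S.guess fun x => ketbra (e x)) +
        √((d : ℝ) - 1) * √(1 - S.p none - S.guess fun x => ketbra (e x))) ^ 2 := by
  have hd1 : (0 : ℝ) ≤ d - 1 := by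
    have : (2 : ℝ) ≤ d := by exact_mod_cast hd
    linarith
  set b : Fin d → ℝ := fun j => born (S.σ (some j)) (ketbra (e j)) with hb
  have hb0 : ∀ j, 0 ≤ b j := fun j => born_nonneg (S.isState _).posSemidef (ketbra_posSemidef _)
  have hb1 : ∀ j, 0 ≤ 1 - b j := fun j => sub_nonneg.2 (born_state_le_one (S.isState _) he j)
  have hp : ∀ j, 0 ≤ S.p (some j) := fun j => S.p_nonneg _
  have hg : S.guess (fun x => ketbra (e x)) = ∑ j, S.p (some j) * b j := rfl
  have hr : 1 - S.p none - S.guess (fun x => ketbra (e x)) =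
    ∑ j, S.p (some j) * (1 - b j) := S.sub_guess_eq
  have hcs : ∑ j, S.p (some j) * (√(b j) * √(1 - b j)) ≤
      √(S.guess fun x => ketbra (e x)) * √(1 - S.p none - S.guess fun x => ketbra (e x)) := by
    rw [hr, hg]
    refine le_trans (le_of_eq ?_) (Real.sum_sqrt_mul_sqrt_le Finset.univ
      (fun j => mul_nonneg (hp j) (hb0 j)) (fun j => mul_nonneg (hp j) (hb1 j)))
    refine Finset.sum_congr rfl fun j _ => ?_
    rw [Real.sqrt_mul (hp j), Real.sqrt_mul (hp j), mul_mul_mul_comm,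
      Real.mul_self_sqrt (hp j)]
  have hst : born ρ (ketbra (∑ x, e x)) = S.p none * born (S.σ none) (ketbra (∑ x, e x)) +
      ∑ j, S.p (some j) * born (S.σ (some j)) (ketbra (∑ x, e x)) := by
    refine (congrArg (fun τ => born τ (ketbra (∑ x, e x))) S.state_eq).symm.trans ?_
    simp only [Fintype.sum_option, born_add_left, born_sum_left, born_smul_left]
  rw [hst]
  refine add_le_add (mul_le_mul_of_nonneg_left (born_sum_le_card (S.isState _) he)
    (S.p_nonneg _)) ?_
  calc ∑ j, S.p (some j) * born (S.σ (some j)) (ketbra (∑ x, e x))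
      ≤ ∑ j, S.p (some j) * (√(b j) + √((d : ℝ) - 1) * √(1 - b j)) ^ 2 :=
        Finset.sum_le_sum fun j _ => mul_le_mul_of_nonneg_left
          (SharedNoise.born_sum_le (S.isState _) he j) (hp j)
    _ = ∑ j, (S.p (some j) * b j + (d - 1) * (S.p (some j) * (1 - b j)) +
          2 * √((d : ℝ) - 1) * (S.p (some j) * (√(b j) * √(1 - b j)))) := by
        refine Finset.sum_congr rfl fun j _ => ?_
        rw [add_sq, mul_pow, Real.sq_sqrt (hb0 j), Real.sq_sqrt (hb1 j), Real.sq_sqrt hd1]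
        ring
    _ = S.guess (fun x => ketbra (e x)) +
          (d - 1) * (1 - S.p none - S.guess fun x => ketbra (e x)) +
          2 * √((d : ℝ) - 1) * ∑ j, S.p (some j) * (√(b j) * √(1 - b j)) := by
        rw [Finset.sum_add_distrib, Finset.sum_add_distrib, ← Finset.mul_sum, ← Finset.mul_sum,
          hr, hg]
    _ ≤ S.guess (fun x => ketbra (e x)) +
          (d - 1) * (1 - S.p none - S.guess fun x => ketbra (e x)) +
          2 * √((d : ℝ) - 1) * (√(S.guess fun x => ketbra (e x)) *
            √(1 - S.p none - S.guess fun x => ketbra (e x))) := by gcongr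
    _ = _ := by
        rw [add_sq, mul_pow, Real.sq_sqrt S.guess_nonneg, Real.sq_sqrt hd1,
          Real.sq_sqrt (sub_nonneg.2 (S.guess_le he))]
        ring

end SingleStrategy

lemma born_depolarize_sqrt_smul (hd : 0 < d) {δ : ℝ} {φ : EuclideanSpace ℂ (Fin d)}
    (hφ : ‖φ‖ = 1) :
    born (depolarize δ (ketbra φ)) (ketbra (√(d : ℝ) • φ)) = d - (d - 1) * δ := by
  have hd' : (0 : ℝ) < d := by exact_mod_cast hd
  rw [ketbra_eq_outer (_ • φ), outer_smul_left, outer_smul_right, smul_smul,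
    Real.mul_self_sqrt hd'.le, born_smul_right, ← ketbra_eq_outer,
    depolarize_ketbra δ hφ, born_add_left, born_smul_left, born_smul_left, born_comm 1,
    born_one_right, born_ketbra_ketbra, trace_ketbra, inner_self_eq_norm_sq_to_K, hφ]
  simp only [Complex.coe_algebraMap, Complex.ofReal_one, one_pow, norm_one, Complex.one_re]
  field_simp
  ring

/-- The noise of the state bounds the strategies of the single eavesdropper. -/
lemma SingleStrategy.sq_sub_le_noise (hd : 2 ≤ d) {δ : ℝ} {φ : EuclideanSpace ℂ (Fin d)}
    (hφ : ‖φ‖ = 1) {e : Fin d → EuclideanSpace ℂ (Fin d)} (he : ∑ x, ketbra (e x) = 1)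
    (heφ : ∑ x, e x = √(d : ℝ) • φ) (S : SingleStrategy (depolarize δ (ketbra φ))) {G h : ℝ}
    (hG : 0 ≤ G) (hh : 0 ≤ h) (hGg : G ^ 2 = S.guess fun x => ketbra (e x))
    (hhg : (d - 1) * h ^ 2 = 1 - S.p none - S.guess fun x => ketbra (e x)) :
    (G - h) ^ 2 ≤ δ := by
  have hd2 : (2 : ℝ) ≤ d := by exact_mod_cast hd
  have hd1 : (0 : ℝ) < d - 1 := by linarith
  have key := S.born_sum_le hd he
  rw [← hGg] at key hhg
  rw [← hhg, Real.sqrt_mul hd1.le, Real.sqrt_sq hG, Real.sqrt_sq hh, ← mul_assoc,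
    Real.mul_self_sqrt hd1.le, heφ, born_depolarize_sqrt_smul (by lia) hφ] at key
  have h2 : S.p none = 1 - G ^ 2 - (d - 1) * h ^ 2 := by linarith
  rw [h2] at key
  -- With `p none` eliminated, `key` reads `d - (d - 1) * δ ≤ d - (d - 1) * (G - h) ^ 2`.
  nlinarith

/-- Write `r = √δ`. If `g` exceeded the bound, then `h < (1 - r) / 2` and so `G < (1 + r) / 2`. The
squares of these two bounds sum to `(1 + r ^ 2) / 2 < 1`, which contradicts `G ^ 2 = g`. -/
lemma guess_le_of_sq_sub_le {G δ g : ℝ} {h : ℝ} (hG : 0 ≤ G) (hg : G ^ 2 = g)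
    (hh1 : h ^ 2 ≤ 1 - g) (hδ : δ < 1) (hGh : (G - h) ^ 2 ≤ δ) :
    g ≤ 1 - ((1 - √δ) / 2) ^ 2 := by
  have hr1 : √δ < 1 := by rw [Real.sqrt_lt' one_pos]; simpa using hδ
  have hr0 := Real.sqrt_nonneg δ
  have h1 : G - h ≤ √δ := Real.le_sqrt_of_sq_le hGh
  by_contra! hc
  have h2 : h < (1 - √δ) / 2 := lt_of_pow_lt_pow_left₀ 2 (by linarith) (by linarith)
  nlinarith

end SharedNoise

namespace SharedNoise

variable {d : ℕ}

/-! ### Ensembles of states and measurements -/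

/-- The probability that the outcome of the POVM `N` on the state `ψ` is the guess. -/
def guessCond (ψ : EuclideanSpace ℂ (Fin d)) (N : Fin d → Matrix (Fin d) (Fin d) ℂ) :
    Option (Fin d) → ℝ
  | none => 0
  | some x => born (ketbra ψ) (N x)

lemma IsPOVM.born_nonneg {N : Fin d → Matrix (Fin d) (Fin d) ℂ} (hN : IsPOVM N)
    (ψ : EuclideanSpace ℂ (Fin d)) (x : Fin d) : 0 ≤ born (ketbra ψ) (N x) :=
  SharedNoise.born_nonneg (ketbra_posSemidef _) (hN.posSemidef x)

lemma IsPOVM.sum_born {N : Fin d → Matrix (Fin d) (Fin d) ℂ} (hN : IsPOVM N)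
    {ψ : EuclideanSpace ℂ (Fin d)} (hψ : ‖ψ‖ = 1) : ∑ x, born (ketbra ψ) (N x) = 1 := by
  rw [← born_sum_right, hN.sum_eq_one, born_one_right, trace_ketbra, hψ]
  simp

lemma IsPOVM.born_le_one {N : Fin d → Matrix (Fin d) (Fin d) ℂ} (hN : IsPOVM N)
    {ψ : EuclideanSpace ℂ (Fin d)} (hψ : ‖ψ‖ = 1) (x : Fin d) : born (ketbra ψ) (N x) ≤ 1 := by
  rw [← hN.sum_born hψ]
  exact Finset.single_le_sum (f := fun x => born (ketbra ψ) (N x))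
    (fun x _ => hN.born_nonneg ψ x) (Finset.mem_univ x)

lemma JointStrategy.guess_le_one {ρ : Matrix (Fin d) (Fin d) ℂ}
    {M : Fin d → Matrix (Fin d) (Fin d) ℂ} (S : JointStrategy ρ M) : S.guess ≤ 1 := by
  rw [guess, ← S.p_sum]
  refine Finset.sum_le_sum fun μ _ => Finset.sum_le_sum fun ν _ =>
    mul_le_of_le_one_right (S.p_nonneg μ ν) ?_
  rcases S.f μ ν with _ | x
  · exact zero_le_one
  · exact (S.isPOVM ν).born_le_one (S.norm_ψ μ) x

/-- Some ensemble of pairs of a pure state and a POVM, each with a guess, has average state `ρ`,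
average measurement `M` and average outcome statistics `P`, and it attains the probabilities `i` of
an inconclusive outcome and `g` of a correct guess. -/
def Realizes (ρ : Matrix (Fin d) (Fin d) ℂ) (M : Fin d → Matrix (Fin d) (Fin d) ℂ)
    (P : Fin d → ℝ) (i g : ℝ) : Prop :=
  ∃ (ι : Type) (_ : Fintype ι) (w : ι → ℝ) (ψ : ι → EuclideanSpace ℂ (Fin d))
    (N : ι → Fin d → Matrix (Fin d) (Fin d) ℂ) (f : ι → Option (Fin d)),
    (∀ k, 0 ≤ w k) ∧ ∑ k, w k = 1 ∧ (∀ k, ‖ψ k‖ = 1) ∧ (∀ k, IsPOVM (N k)) ∧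
    ∑ k, w k • ketbra (ψ k) = ρ ∧ (∀ x, ∑ k, w k • N k x = M x) ∧
    (∀ x, ∑ k, w k * born (ketbra (ψ k)) (N k x) = P x) ∧
    ∑ k, (if f k = none then w k else 0) = i ∧ ∑ k, w k * guessCond (ψ k) (N k) (f k) = g

/-- State and measurement average linearly, but the Born statistics of the averages are bilinear in
the pair. Hence `P` is a separate parameter, common to both ensembles. -/
lemma Realizes.mix {ρ₁ ρ₂ : Matrix (Fin d) (Fin d) ℂ} {M₁ M₂ : Fin d → Matrix (Fin d) (Fin d) ℂ}
    {P : Fin d → ℝ} {i₁ i₂ g₁ g₂ : ℝ} (h₁ : Realizes ρ₁ M₁ P i₁ g₁) (h₂ : Realizes ρ₂ M₂ P i₂ g₂)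
    {q : ℝ} (hq0 : 0 ≤ q) (hq1 : q ≤ 1) :
    Realizes ((1 - q) • ρ₁ + q • ρ₂) (fun x => (1 - q) • M₁ x + q • M₂ x) P
      ((1 - q) * i₁ + q * i₂) ((1 - q) * g₁ + q * g₂) := by
  obtain ⟨ι₁, _, w₁, ψ₁, N₁, f₁, hw₁, hs₁, hψ₁, hN₁, hρ₁, hM₁, hP₁, hi₁, hg₁⟩ := h₁
  obtain ⟨ι₂, _, w₂, ψ₂, N₂, f₂, hw₂, hs₂, hψ₂, hN₂, hρ₂, hM₂, hP₂, hi₂, hg₂⟩ := h₂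
  refine ⟨ι₁ ⊕ ι₂, inferInstance, Sum.elim (fun k => (1 - q) * w₁ k) (fun k => q * w₂ k),
    Sum.elim ψ₁ ψ₂, Sum.elim N₁ N₂, Sum.elim f₁ f₂, ?_, ?_, ?_, ?_, ?_, ?_, ?_, ?_, ?_⟩
  · rintro (k | k)
    · exact mul_nonneg (by linarith) (hw₁ k)
    · exact mul_nonneg hq0 (hw₂ k)
  · simp [Fintype.sum_sum_type, ← Finset.mul_sum, hs₁, hs₂]
  · rintro (k | k)
    · exact hψ₁ k
    · exact hψ₂ k
  · rintro (k | k)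
    · exact hN₁ k
    · exact hN₂ k
  · simp [Fintype.sum_sum_type, mul_smul, ← Finset.smul_sum, hρ₁, hρ₂]
  · intro x
    simp [Fintype.sum_sum_type, mul_smul, ← Finset.smul_sum, hM₁, hM₂]
  · intro x
    simp only [Fintype.sum_sum_type, Sum.elim_inl, Sum.elim_inr, mul_assoc, ← Finset.mul_sum,
      hP₁, hP₂]
    ring
  · simp only [Fintype.sum_sum_type, Sum.elim_inl, Sum.elim_inr, ← hi₁, ← hi₂, Finset.mul_sum,
      mul_ite, mul_zero]
    congr!
  · simp only [Fintype.sum_sum_type, Sum.elim_inl, Sum.elim_inr, mul_assoc, ← Finset.mul_sum,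
      hg₁, hg₂]

/-- States and POVMs are both indexed by the ensemble, and the joint distribution is supported on
the diagonal. -/
lemma Realizes.exists_jointStrategy {ρ : Matrix (Fin d) (Fin d) ℂ}
    {M : Fin d → Matrix (Fin d) (Fin d) ℂ} {i g : ℝ}
    (h : Realizes ρ M (fun x => born ρ (M x)) i g) :
    ∃ S : JointStrategy ρ M, S.inconclusive = i ∧ S.guess = g := by
  obtain ⟨ι, _, w, ψ, N, f, hw, hs, hψ, hN, hρ, hM, hP, hi, hg⟩ := h
  let n := Fintype.card ι
  let E : Fin n ≃ ι := (Fintype.equivFin ι).symm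
  have diag {A : Type} [AddCommMonoid A] (F : Fin n → Fin n → A) (G : ι → A)
      (h0 : ∀ μ ν, ν ≠ μ → F μ ν = 0) (h1 : ∀ μ, F μ μ = G (E μ)) :
      ∑ μ, ∑ ν, F μ ν = ∑ k, G k := by
    rw [← E.sum_comp]
    refine Finset.sum_congr rfl fun μ _ => ?_
    rw [Finset.sum_eq_single μ (fun ν _ hν => h0 μ ν hν) (by simp), h1]
  let S : JointStrategy ρ M :=
    { k := n
      l := n
      p := fun μ ν => if ν = μ then w (E μ) else 0
      ψ := fun μ => ψ (E μ)
      N := fun ν => N (E ν)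
      f := fun μ _ => f (E μ)
      p_nonneg := fun μ ν => by
        split_ifs
        · exact hw _
        · exact le_rfl
      p_sum := by rw [← hs]; exact diag _ _ (by simp +contextual) (by simp)
      norm_ψ := fun μ => hψ _
      isPOVM := fun ν => hN _
      state_eq := by rw [← hρ]; exact diag _ _ (by simp +contextual) (by simp)
      meas_eq := fun x => by rw [← hM]; exact diag _ _ (by simp +contextual) (by simp)
      born_eq := fun x => by
        refine Eq.trans ?_ (hP x)
        exact diag _ (fun k => w k * born (ketbra (ψ k)) (N k x)) (by simp +contextual) (by simp) }
  refine ⟨S, ?_, ?_⟩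
  · rw [← hi]
    exact diag _ _ (fun μ ν hν => by simp [S, hν]) (fun μ => by simp [S])
  · rw [← hg]
    refine diag _ _ (fun μ ν hν => by simp [S, hν]) (fun μ => ?_)
    simp only [S, if_true]
    cases h : f (E μ) <;> simp [JointStrategy.cond, guessCond]

end SharedNoise

namespace SharedNoise

variable {d : ℕ}

/-! ### States and measurements tilted towards an unbiased vector -/

noncomputable section

/-- The vector with coefficient `a` at `e x` and `s` at the other vectors of the basis `e`. -/
def tiltedState (e : Fin d → EuclideanSpace ℂ (Fin d)) (a s : ℝ) (x : Fin d) :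
    EuclideanSpace ℂ (Fin d) :=
  (a - s) • e x + s • ∑ z, e z

/-- A POVM whose elements for the outcomes other than `x` annihilate `tiltedState e a s x`. -/
def tiltedMeas (e : Fin d → EuclideanSpace ℂ (Fin d)) (a s : ℝ) (x y : Fin d) :
    Matrix (Fin d) (Fin d) ℂ :=
  if y = x then
    ((d : ℝ) - 1)⁻¹ • ∑ z ∈ Finset.univ.erase x, ketbra (a • e x + (((d : ℝ) - 1) * s) • e z)
  else ketbra (a • e y - s • e x)

variable {e : Fin d → EuclideanSpace ℂ (Fin d)} {φ : EuclideanSpace ℂ (Fin d)}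

lemma inner_tiltedState (he : Orthonormal ℂ e) (a s : ℝ) (x y : Fin d) :
    inner ℂ (e y) (tiltedState e a s x) = if y = x then (a : ℂ) else (s : ℂ) := by
  have h := orthonormal_iff_ite.1 he
  rw [tiltedState, inner_add_right, inner_smul_right_eq_smul, inner_smul_right_eq_smul, inner_sum]
  simp only [h]
  split_ifs <;> simp

lemma norm_tiltedState (he : Orthonormal ℂ e) {a s : ℝ} (has : a ^ 2 + (d - 1) * s ^ 2 = 1)
    (x : Fin d) : ‖tiltedState e a s x‖ = 1 := by
  have h1 : inner ℂ (tiltedState e a s x) (tiltedState e a s x) = (1 : ℂ) := by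
    -- Only the left argument is expanded; the right one stays in the form required by
    -- `inner_tiltedState`.
    conv_lhs => enter [2]; rw [tiltedState]
    rw [inner_add_left, inner_smul_left_eq_smul, inner_smul_left_eq_smul, sum_inner]
    simp only [inner_tiltedState he]
    rw [← Finset.add_sum_erase _ _ (Finset.mem_univ x), Finset.sum_congr rfl
      (g := fun _ => (s : ℂ)) (fun z hz => if_neg (Finset.ne_of_mem_erase hz))]
    have : ((d - 1 : ℕ) : ℂ) = d - 1 := by
      rw [Nat.cast_sub x.pos, Nat.cast_one]
    simp only [if_true, Finset.sum_const, Finset.card_erase_of_mem (Finset.mem_univ x),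
      Finset.card_univ, Fintype.card_fin, nsmul_eq_mul, this, Complex.real_smul]
    have has' : (a : ℂ) ^ 2 + (d - 1) * (s : ℂ) ^ 2 = 1 := by exact_mod_cast has
    push_cast
    linear_combination has'
  rw [inner_self_eq_norm_sq_to_K] at h1
  have h2 : ‖tiltedState e a s x‖ ^ 2 = 1 := Complex.ofReal_injective (by simpa using h1)
  exact (pow_eq_one_iff_of_nonneg (norm_nonneg _) two_ne_zero).1 h2

lemma sum_ketbra_tiltedState (he : ∑ x, ketbra (e x) = 1) (heφ : ∑ x, e x = √(d : ℝ) • φ)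
    (a s : ℝ) : ∑ x, ketbra (tiltedState e a s x) =
      (a - s) ^ 2 • (1 : Matrix (Fin d) (Fin d) ℂ) + (d * (2 * (a - s) * s + d * s ^ 2)) •
        ketbra φ := by
  have hU : outer (∑ x, e x) (∑ x, e x) = (d : ℝ) • ketbra φ := by
    rw [heφ, outer_smul_left, outer_smul_right, smul_smul, Real.mul_self_sqrt d.cast_nonneg,
      ketbra_eq_outer]
  have h : ∀ x, ketbra (tiltedState e a s x) = (a - s) ^ 2 • ketbra (e x) +
      ((a - s) * s) • (outer (e x) (∑ z, e z) + outer (∑ z, e z) (e x)) +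
      s ^ 2 • outer (∑ z, e z) (∑ z, e z) := fun x => by
    simp only [tiltedState, ketbra_eq_outer, outer_add_left, outer_add_right, outer_smul_left,
      outer_smul_right]
    module
  simp only [h, Finset.sum_add_distrib, ← Finset.smul_sum, ← outer_sum_left, ← outer_sum_right,
    he, hU, Finset.sum_const, Finset.card_univ, Fintype.card_fin, ← Nat.cast_smul_eq_nsmul ℝ]
  module

lemma ketbra_smul_sub_smul (a s : ℝ) (v w : EuclideanSpace ℂ (Fin d)) :
    ketbra (a • v - s • w) =
      a ^ 2 • ketbra v + s ^ 2 • ketbra w - (a * s) • (outer v w + outer w v) := by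
  simp only [ketbra_eq_outer, outer_sub_left, outer_sub_right, outer_smul_left, outer_smul_right]
  module

lemma tiltedMeas_of_ne (a s : ℝ) {x y : Fin d} (h : y ≠ x) :
    tiltedMeas e a s x y = a ^ 2 • ketbra (e y) + s ^ 2 • ketbra (e x) -
      (a * s) • (outer (e y) (e x) + outer (e x) (e y)) := by
  rw [tiltedMeas, if_neg h, ketbra_smul_sub_smul]

/-- The definition as an average of rank-one terms makes positivity evident; this expanded form
serves for the sums over either index. -/
lemma tiltedMeas_self (hd : 2 ≤ d) (he : ∑ x, ketbra (e x) = 1) (a s : ℝ) (x : Fin d) :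
    tiltedMeas e a s x x = a ^ 2 • ketbra (e x) + (a * s) •
      (outer (∑ z, e z) (e x) + outer (e x) (∑ z, e z) - (2 : ℝ) • ketbra (e x)) +
      (((d : ℝ) - 1) * s ^ 2) • (1 - ketbra (e x)) := by
  have hd2 : (2 : ℝ) ≤ d := by exact_mod_cast hd
  have hd1 : (d : ℝ) - 1 ≠ 0 := by linarith
  have h : ∀ z, ketbra (a • e x + (((d : ℝ) - 1) * s) • e z) = a ^ 2 • ketbra (e x) +
      (a * ((d - 1) * s)) • (outer (e x) (e z) + outer (e z) (e x)) +
      (((d : ℝ) - 1) * s) ^ 2 • ketbra (e z) := fun z => by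
    simp only [ketbra_eq_outer, outer_add_left, outer_add_right, outer_smul_left,
      outer_smul_right]
    module
  rw [tiltedMeas, if_pos rfl, inv_smul_eq_iff₀ hd1, Finset.sum_erase_eq_sub (Finset.mem_univ x)]
  simp only [h, Finset.sum_add_distrib, ← Finset.smul_sum, ← outer_sum_left, ← outer_sum_right,
    he, Finset.sum_const, Finset.card_univ, Fintype.card_fin, ← Nat.cast_smul_eq_nsmul ℝ]
  rw [← ketbra_eq_outer]
  module

lemma sum_tiltedMeas_right (hd : 2 ≤ d) (he : ∑ x, ketbra (e x) = 1) {a s : ℝ}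
    (has : a ^ 2 + (d - 1) * s ^ 2 = 1) (x : Fin d) : ∑ y, tiltedMeas e a s x y = 1 := by
  rw [← Finset.add_sum_erase _ _ (Finset.mem_univ x), Finset.sum_congr rfl
    (fun y hy => tiltedMeas_of_ne a s (Finset.ne_of_mem_erase hy)),
    Finset.sum_erase_eq_sub (Finset.mem_univ x), tiltedMeas_self hd he]
  simp only [Finset.sum_sub_distrib, Finset.sum_add_distrib, ← Finset.smul_sum,
    ← outer_sum_left, ← outer_sum_right,
    he, Finset.sum_const, Finset.card_univ, Fintype.card_fin, ← Nat.cast_smul_eq_nsmul ℝ]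
  rw [← ketbra_eq_outer]
  conv_rhs => rw [← one_smul ℝ (1 : Matrix (Fin d) (Fin d) ℂ), ← has]
  module

lemma sum_tiltedMeas_left (hd : 2 ≤ d) (he : ∑ x, ketbra (e x) = 1) (a s : ℝ) (y : Fin d) :
    ∑ x, tiltedMeas e a s x y = (d * a ^ 2) • ketbra (e y) + (d * s ^ 2) • (1 - ketbra (e y)) := by
  rw [← Finset.add_sum_erase _ _ (Finset.mem_univ y), Finset.sum_congr rfl
    (fun x hx => tiltedMeas_of_ne a s (Finset.ne_of_mem_erase hx).symm),
    Finset.sum_erase_eq_sub (Finset.mem_univ y), tiltedMeas_self hd he]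
  simp only [Finset.sum_sub_distrib, Finset.sum_add_distrib, ← Finset.smul_sum,
    ← outer_sum_left, ← outer_sum_right,
    he, Finset.sum_const, Finset.card_univ, Fintype.card_fin, ← Nat.cast_smul_eq_nsmul ℝ]
  rw [← ketbra_eq_outer]
  module

lemma isPOVM_tiltedMeas (hd : 2 ≤ d) (he : ∑ x, ketbra (e x) = 1) {a s : ℝ}
    (has : a ^ 2 + (d - 1) * s ^ 2 = 1) (x : Fin d) : IsPOVM (tiltedMeas e a s x) where
  posSemidef y := by
    rw [tiltedMeas]
    split_ifs
    · have hd2 : (2 : ℝ) ≤ d := by exact_mod_cast hd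
      exact (Matrix.posSemidef_sum _ fun z _ => ketbra_posSemidef _).smul
        (inv_nonneg.2 (by linarith))
    · exact ketbra_posSemidef _
  sum_eq_one := sum_tiltedMeas_right hd he has x

/-- The amplitude is the determinant of the coefficient pairs of state and measurement, so it
vanishes when the two tilts coincide. -/
lemma born_tilted_of_ne (he : Orthonormal ℂ e) (a₁ s₁ a₂ s₂ : ℝ) {x y : Fin d} (h : y ≠ x) :
    born (ketbra (tiltedState e a₁ s₁ x)) (tiltedMeas e a₂ s₂ x y) =
      (a₂ * s₁ - s₂ * a₁) ^ 2 := by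
  rw [tiltedMeas, if_neg h, born_comm, born_ketbra_ketbra, inner_sub_left,
    inner_smul_left_eq_smul, inner_smul_left_eq_smul, inner_tiltedState he, inner_tiltedState he,
    if_neg h, if_pos rfl, ← sq_abs (a₂ * s₁ - s₂ * a₁), ← Real.norm_eq_abs,
    ← Complex.norm_real]
  simp

lemma sum_born_tilted_of_ne (he : Orthonormal ℂ e) (a₁ s₁ a₂ s₂ : ℝ) (x : Fin d) :
    ∑ y ∈ Finset.univ.erase x, born (ketbra (tiltedState e a₁ s₁ x)) (tiltedMeas e a₂ s₂ x y) =
      (d - 1) * (a₂ * s₁ - s₂ * a₁) ^ 2 := by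
  rw [Finset.sum_congr rfl
    (fun y hy => born_tilted_of_ne he a₁ s₁ a₂ s₂ (Finset.ne_of_mem_erase hy)),
    Finset.sum_const, Finset.card_erase_of_mem (Finset.mem_univ x), Finset.card_univ,
    Fintype.card_fin, nsmul_eq_mul, Nat.cast_sub x.pos, Nat.cast_one]

lemma born_tilted_self (hd : 2 ≤ d) (he : Orthonormal ℂ e) (he1 : ∑ x, ketbra (e x) = 1)
    {a₁ s₁ a₂ s₂ : ℝ} (h₁ : a₁ ^ 2 + (d - 1) * s₁ ^ 2 = 1) (h₂ : a₂ ^ 2 + (d - 1) * s₂ ^ 2 = 1)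
    (x : Fin d) : born (ketbra (tiltedState e a₁ s₁ x)) (tiltedMeas e a₂ s₂ x x) =
      1 - (d - 1) * (a₂ * s₁ - s₂ * a₁) ^ 2 := by
  have h := (isPOVM_tiltedMeas hd he1 h₂ x).sum_born (norm_tiltedState he h₁ x)
  rw [← Finset.add_sum_erase _ _ (Finset.mem_univ x), sum_born_tilted_of_ne he] at h
  linarith

lemma sq_norm_inner_of_sum_eq (he : Orthonormal ℂ e)
    (heφ : ∑ x, e x = √(d : ℝ) • φ) (y : Fin d) : ‖inner ℂ (e y) φ‖ ^ 2 = (d : ℝ)⁻¹ := by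
  have h : √(d : ℝ) • inner ℂ (e y) φ = 1 := by
    rw [← inner_smul_right_eq_smul, ← heφ, inner_sum]
    simp [orthonormal_iff_ite.1 he]
  have h2 := congrArg (fun z : ℂ => ‖z‖ ^ 2) h
  simp only [norm_smul, mul_pow, Real.norm_eq_abs, sq_abs, Real.sq_sqrt d.cast_nonneg, norm_one,
    one_pow] at h2
  exact eq_inv_of_mul_eq_one_right h2

/-! ### Strategies with depolarized averages -/

/-- Some ensemble realizes `φ` with noise `ηs` and the measurement in the basis `e` with noise `ηm`
and uniform outcome statistics, with probabilities `i` and `g` of an inconclusive outcome and of a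
correct guess. -/
def NoisyRealizes (e : Fin d → EuclideanSpace ℂ (Fin d)) (φ : EuclideanSpace ℂ (Fin d))
    (ηs ηm i g : ℝ) : Prop :=
  Realizes (depolarize ηs (ketbra φ)) (fun x => depolarize ηm (ketbra (e x)))
    (fun _ => (d : ℝ)⁻¹) i g

lemma depolarize_mix {v : EuclideanSpace ℂ (Fin d)} (hv : ‖v‖ = 1) (q η₁ η₂ : ℝ) :
    (1 - q) • depolarize η₁ (ketbra v) + q • depolarize η₂ (ketbra v) =
      depolarize ((1 - q) * η₁ + q * η₂) (ketbra v) := by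
  simp only [depolarize_ketbra _ hv, div_eq_mul_inv]
  module

lemma NoisyRealizes.mix (he : Orthonormal ℂ e) (hφ : ‖φ‖ = 1) {ηs₁ ηm₁ i₁ g₁ ηs₂ ηm₂ i₂ g₂ : ℝ}
    (h₁ : NoisyRealizes e φ ηs₁ ηm₁ i₁ g₁) (h₂ : NoisyRealizes e φ ηs₂ ηm₂ i₂ g₂)
    {q : ℝ} (hq0 : 0 ≤ q) (hq1 : q ≤ 1) :
    NoisyRealizes e φ ((1 - q) * ηs₁ + q * ηs₂) ((1 - q) * ηm₁ + q * ηm₂)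
      ((1 - q) * i₁ + q * i₂) ((1 - q) * g₁ + q * g₂) := by
  have h := Realizes.mix h₁ h₂ hq0 hq1
  simp only [depolarize_mix hφ, depolarize_mix (he.norm_eq_one _)] at h
  exact h

/-- Averaging over a uniform `x` restores the symmetry among the basis vectors, so the mean state
and measurement are depolarized. The outcome `x` is guessed, and it fails to occur only through the
`d - 1` determinants. -/
lemma noisyRealizes_tilted (hd : 2 ≤ d) (he : Orthonormal ℂ e) (he1 : ∑ x, ketbra (e x) = 1)
    (hφ : ‖φ‖ = 1) (heφ : ∑ x, e x = √(d : ℝ) • φ) {a₁ s₁ a₂ s₂ : ℝ}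
    (h₁ : a₁ ^ 2 + (d - 1) * s₁ ^ 2 = 1) (h₂ : a₂ ^ 2 + (d - 1) * s₂ ^ 2 = 1) :
    NoisyRealizes e φ ((a₁ - s₁) ^ 2) (d * s₂ ^ 2) 0
      (1 - (d - 1) * (a₂ * s₁ - s₂ * a₁) ^ 2) := by
  have hd0 : (d : ℝ) ≠ 0 := by
    have : d ≠ 0 := by lia
    exact_mod_cast this
  refine ⟨Fin d, inferInstance, fun _ => (d : ℝ)⁻¹, tiltedState e a₁ s₁, tiltedMeas e a₂ s₂,
    some, fun _ => by positivity, by simp [hd0], norm_tiltedState he h₁,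
    isPOVM_tiltedMeas hd he1 h₂, ?_, fun y => ?_, fun y => ?_, by simp, ?_⟩
  · rw [← Finset.smul_sum, sum_ketbra_tiltedState he1 heφ, depolarize_ketbra _ hφ,
      inv_smul_eq_iff₀ hd0, smul_add, smul_smul, smul_smul, mul_div_cancel₀ _ hd0, add_comm]
    congr 3
    linear_combination h₁
  · beta_reduce
    rw [← Finset.smul_sum, sum_tiltedMeas_left hd he1, depolarize_ketbra _ (he.norm_eq_one y),
      inv_smul_eq_iff₀ hd0, smul_add, smul_smul, smul_smul, mul_div_cancel₀ _ hd0]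
    rw [show (d : ℝ) * (1 - d * s₂ ^ 2) = d * a₂ ^ 2 - d * s₂ ^ 2 by
      linear_combination (-(d : ℝ)) * h₂]
    module
  · rw [← Finset.mul_sum, ← Finset.add_sum_erase _ _ (Finset.mem_univ y),
      born_tilted_self hd he he1 h₁ h₂, Finset.sum_congr rfl
      (fun x hx => born_tilted_of_ne he a₁ s₁ a₂ s₂ (Finset.ne_of_mem_erase hx).symm),
      Finset.sum_const, Finset.card_erase_of_mem (Finset.mem_univ y), Finset.card_univ,
      Fintype.card_fin, nsmul_eq_mul, Nat.cast_sub y.pos, Nat.cast_one]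
    ring
  · simp only [guessCond, born_tilted_self hd he he1 h₁ h₂, Finset.sum_const, Finset.card_univ,
      Fintype.card_fin, nsmul_eq_mul]
    field_simp

/-- Maximally mixed state and measurement: send basis states and the trivial measurements. -/
lemma noisyRealizes_trivial (hd : 2 ≤ d) (he : Orthonormal ℂ e) (he1 : ∑ x, ketbra (e x) = 1)
    (hφ : ‖φ‖ = 1) : NoisyRealizes e φ 1 1 0 1 := by
  have hd0 : (d : ℝ) ≠ 0 := by
    have : d ≠ 0 := by lia
    exact_mod_cast this
  have hb : ∀ x, born (ketbra (e x)) 1 = 1 := fun x => by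
    rw [born_one_right, trace_ketbra, he.norm_eq_one]
    simp
  refine ⟨Fin d, inferInstance, fun _ => (d : ℝ)⁻¹, e, fun x y => if y = x then 1 else 0,
    some, fun _ => by positivity, by simp [hd0], he.norm_eq_one,
    fun x => ⟨fun y => ?_, by simp⟩, ?_, fun y => ?_, fun y => ?_, by simp, ?_⟩
  · beta_reduce
    split_ifs
    · exact Matrix.PosSemidef.one
    · exact Matrix.PosSemidef.zero
  · rw [← Finset.smul_sum, he1, depolarize_ketbra _ hφ]
    simp
  · beta_reduce
    rw [depolarize_ketbra _ (he.norm_eq_one y)]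
    simp
  · rw [Finset.sum_eq_single y (fun x _ hx => by simp [hx.symm, born]) (by simp)]
    simp [hb]
  · simp [guessCond, hb, hd0]

/-- Ideal state and measurement with an inconclusive answer. -/
lemma noisyRealizes_inconclusive (he : Orthonormal ℂ e)
    (he1 : ∑ x, ketbra (e x) = 1) (hφ : ‖φ‖ = 1) (heφ : ∑ x, e x = √(d : ℝ) • φ) :
    NoisyRealizes e φ 0 0 1 0 := by
  refine ⟨Unit, inferInstance, fun _ => 1, fun _ => φ, fun _ x => ketbra (e x), fun _ => none,
    fun _ => zero_le_one, by simp, fun _ => hφ, fun _ => ⟨fun _ => ketbra_posSemidef _, he1⟩,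
    ?_, fun y => ?_, fun y => ?_, by simp, by simp [guessCond]⟩
  · simp [depolarize]
  · simp [depolarize]
  · simp only [Finset.univ_unique, Finset.sum_singleton, one_mul]
    rw [born_comm, born_ketbra_ketbra, sq_norm_inner_of_sum_eq he heφ]

end

end SharedNoise

namespace SharedNoise

variable {d : ℕ} {e : Fin d → EuclideanSpace ℂ (Fin d)} {φ : EuclideanSpace ℂ (Fin d)}

/-! ### Tuning the noise and comparing the two eavesdroppers. -/

lemma born_depolarize_depolarize (hd : 0 < d) (he : Orthonormal ℂ e) (hφ : ‖φ‖ = 1)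
    (heφ : ∑ x, e x = √(d : ℝ) • φ) (ε : ℝ) (x : Fin d) :
    born (depolarize ε (ketbra φ)) (depolarize ε (ketbra (e x))) = (d : ℝ)⁻¹ := by
  have hd0 : (d : ℝ) ≠ 0 := by
    have : d ≠ 0 := by lia
    exact_mod_cast this
  have h1 : ∀ v : EuclideanSpace ℂ (Fin d), ‖v‖ = 1 → born (ketbra v) 1 = 1 := fun v hv => by
    rw [born_one_right, trace_ketbra, hv]
    simp
  have h2 : born (1 : Matrix (Fin d) (Fin d) ℂ) 1 = d := by simp [born]
  rw [depolarize_ketbra _ hφ, depolarize_ketbra _ (he.norm_eq_one x)]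
  simp only [born_add_left, born_add_right, born_smul_left, born_smul_right, h1 φ hφ,
    born_comm 1 (ketbra (e x)), h1 _ (he.norm_eq_one x), h2]
  rw [born_comm, born_ketbra_ketbra, sq_norm_inner_of_sum_eq he heφ]
  field_simp
  ring

lemma NoisyRealizes.exists_jointStrategy (hd : 0 < d) (he : Orthonormal ℂ e) (hφ : ‖φ‖ = 1)
    (heφ : ∑ x, e x = √(d : ℝ) • φ) {ε i g : ℝ} (h : NoisyRealizes e φ ε ε i g) :
    ∃ S : JointStrategy (depolarize ε (ketbra φ)) (fun x => depolarize ε (ketbra (e x))),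
      S.inconclusive = i ∧ S.guess = g := by
  apply Realizes.exists_jointStrategy
  simp only [born_depolarize_depolarize hd he hφ heφ]
  exact h

/-- Half of the time the state is tilted, and half of the time the measurement. -/
lemma noisyRealizes_balanced (hd : 2 ≤ d) (he : Orthonormal ℂ e) (he1 : ∑ x, ketbra (e x) = 1)
    (hφ : ‖φ‖ = 1) (heφ : ∑ x, e x = √(d : ℝ) • φ) {a s : ℝ}
    (h : a ^ 2 + (d - 1) * s ^ 2 = 1) :
    NoisyRealizes e φ ((a - s) ^ 2 / 2) ((a - s) ^ 2 / 2) 0 (a ^ 2) := by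
  have hd0 : (0 : ℝ) < d := by
    have : 0 < d := by lia
    exact_mod_cast this
  have hr : √(d : ℝ) ≠ 0 := (Real.sqrt_pos.2 hd0).ne'
  have hr2 : √(d : ℝ) ^ 2 = d := Real.sq_sqrt hd0.le
  have h₁ := noisyRealizes_tilted hd he he1 hφ heφ h
    (show (1 : ℝ) ^ 2 + (d - 1) * (0 : ℝ) ^ 2 = 1 by ring)
  -- Here the state is `φ` itself. The measurement coefficients are those of the image of
  -- `tiltedState e a s x` under the reflection exchanging `e x` and `φ`, so noise and error are the
  -- same as in `h₁` with the roles of state and measurement swapped.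
  have h₂ := noisyRealizes_tilted hd he he1 hφ heφ (a₁ := 1 / √d) (s₁ := 1 / √d)
    (a₂ := (a + (d - 1) * s) / √d) (s₂ := (a - s) / √d)
    (by rw [div_pow, hr2]; field_simp; ring)
    (by rw [div_pow, div_pow, hr2]; field_simp; linear_combination (d : ℝ) * h)
  have hm := h₁.mix he hφ h₂ (q := 1 / 2) (by norm_num) (by norm_num)
  have e1 : (d : ℝ) * ((a - s) / √d) ^ 2 = (a - s) ^ 2 := by
    rw [div_pow, hr2]; field_simp
  have e2 : (a + (d - 1) * s) / √(d : ℝ) * (1 / √d) - (a - s) / √d * (1 / √d) = s := by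
    have : (a + (d - 1) * s) / √(d : ℝ) * (1 / √d) - (a - s) / √d * (1 / √d) =
      (d * s) / √(d : ℝ) ^ 2 := by ring
    rw [this, hr2, mul_div_cancel_left₀ _ hd0.ne']
  rw [e1, e2] at hm
  convert hm using 1
  · ring
  · ring
  · ring
  · linear_combination h

/-- The pair `(G, h)` is normalized by `√p` and used with probability `p`; the ideal inconclusive
ensemble, free of noise, takes the rest. The case `p = 0` is separate because of the division. -/
lemma noisyRealizes_of_sq_add_eq (hd : 2 ≤ d) (he : Orthonormal ℂ e)
    (he1 : ∑ x, ketbra (e x) = 1) (hφ : ‖φ‖ = 1) (heφ : ∑ x, e x = √(d : ℝ) • φ) {G h p : ℝ}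
    (hp0 : 0 ≤ p) (hp1 : p ≤ 1) (hGh : G ^ 2 + (d - 1) * h ^ 2 = p) :
    NoisyRealizes e φ ((G - h) ^ 2 / 2) ((G - h) ^ 2 / 2) (1 - p) (G ^ 2) := by
  have hi := noisyRealizes_inconclusive he he1 hφ heφ
  have hd1 : (0 : ℝ) < d - 1 := by
    have : (2 : ℝ) ≤ d := by exact_mod_cast hd
    linarith
  rcases hp0.eq_or_lt with rfl | hp
  · have hG : G = 0 := pow_eq_zero_iff two_ne_zero |>.1 (by nlinarith [sq_nonneg G, sq_nonneg h])
    have hh : h = 0 := by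
      rw [hG] at hGh
      simpa [hd1.ne'] using hGh
    simpa [hG, hh] using hi
  · have hr : √p ^ 2 = p := Real.sq_sqrt hp0
    have hb := noisyRealizes_balanced hd he he1 hφ heφ (a := G / √p) (s := h / √p)
      (by rw [div_pow, div_pow, hr]; field_simp; exact hGh)
    have hm := hi.mix he hφ hb hp0 hp1
    rw [← sub_div, div_pow, div_pow, hr] at hm
    convert hm using 1
    · field_simp; ring
    · field_simp; ring
    · ring
    · field_simp; ring

/-- State and measurement tilted halfway towards each other give perfect guesses. -/
lemma noisyRealizes_critNoise (hd : 2 ≤ d) (he : Orthonormal ℂ e)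
    (he1 : ∑ x, ketbra (e x) = 1) (hφ : ‖φ‖ = 1) (heφ : ∑ x, e x = √(d : ℝ) • φ) :
    NoisyRealizes e φ (critNoise d) (critNoise d) 0 1 := by
  have hd0 : (0 : ℝ) < d := by
    have : 0 < d := by lia
    exact_mod_cast this
  have hr : 0 < √(d : ℝ) := Real.sqrt_pos.2 hd0
  have hr2 : √(d : ℝ) ^ 2 = d := Real.sq_sqrt hd0.le
  -- Equal noises `(a - s) ^ 2 = d * s ^ 2` call for `a = (1 + √d) * s`; normalization then fixes
  -- `s`.
  set s : ℝ := √(1 / (2 * (d + √(d : ℝ)))) with hs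
  have hs2 : s ^ 2 = 1 / (2 * (d + √(d : ℝ))) := Real.sq_sqrt (by positivity)
  have hs3 : s ^ 2 * (2 * (d + √(d : ℝ))) = 1 := by rw [hs2]; field_simp
  have h : ((1 + √(d : ℝ)) * s) ^ 2 + (d - 1) * s ^ 2 = 1 := by
    linear_combination hs3 + s ^ 2 * hr2
  have ht := noisyRealizes_tilted hd he he1 hφ heφ h h
  have hc : d * s ^ 2 = critNoise d := by rw [hs2, critNoise]; ring
  convert ht using 1
  · rw [← hc]; linear_combination (-s ^ 2) * hr2
  · exact hc.symm
  · ring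

/-- With noise beyond the critical value the joint eavesdropper guesses perfectly. -/
lemma noisyRealizes_of_critNoise_le (hd : 2 ≤ d) (he : Orthonormal ℂ e)
    (he1 : ∑ x, ketbra (e x) = 1) (hφ : ‖φ‖ = 1) (heφ : ∑ x, e x = √(d : ℝ) • φ) {ε : ℝ}
    (hε : critNoise d ≤ ε) (hε1 : ε ≤ 1) : NoisyRealizes e φ ε ε 0 1 := by
  have hc : critNoise d < 1 := by
    have hd0 : (0 : ℝ) < d := by
      have : 0 < d := by lia
      exact_mod_cast this
    rw [critNoise, div_lt_one (by positivity)]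
    linarith [Real.sqrt_nonneg (d : ℝ)]
  have hc1 : 0 < 1 - critNoise d := by linarith
  have hm := (noisyRealizes_critNoise hd he he1 hφ heφ).mix he hφ
    (noisyRealizes_trivial hd he he1 hφ) (q := (ε - critNoise d) / (1 - critNoise d))
    (div_nonneg (by linarith) hc1.le) ((div_le_one hc1).2 (by linarith))
  convert hm using 1
  · field_simp; ring
  · field_simp; ring
  · ring
  · ring

/-- The joint eavesdropper improves on each strategy of the single eavesdropper. -/
lemma SingleStrategy.exists_jointStrategy (hd : 2 ≤ d) (he : Orthonormal ℂ e)
    (he1 : ∑ x, ketbra (e x) = 1) (hφ : ‖φ‖ = 1) (heφ : ∑ x, e x = √(d : ℝ) • φ) {ε : ℝ}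
    (hε0 : 0 < ε) (hε1 : ε < 1) (S : SingleStrategy (depolarize (ε * (2 - ε)) (ketbra φ))) :
    ∃ J : JointStrategy (depolarize ε (ketbra φ)) (fun x => depolarize ε (ketbra (e x))),
      J.error ≤ S.error (fun x => ketbra (e x)) ∧
      S.guess (fun x => ketbra (e x)) +
        ε ^ 2 / 2 * ((1 - √(ε * (2 - ε))) / 2) ^ 2 ≤ J.guess := by
  have hd1 : (1 : ℝ) ≤ d - 1 := by
    have : (2 : ℝ) ≤ d := by exact_mod_cast hd
    linarith
  have hd1' : (0 : ℝ) < d - 1 := by linarith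
  set g := S.guess (fun x => ketbra (e x)) with hg
  have hgp : g ≤ 1 - S.p none := S.guess_le he1
  have hG : √g ^ 2 = g := Real.sq_sqrt S.guess_nonneg
  have hp0 := S.p_nonneg none
  -- The error is spread evenly over the `d - 1` wrong outcomes.
  set h := √((1 - S.p none - g) / (d - 1)) with hh
  have hh2 : (d - 1) * h ^ 2 = 1 - S.p none - g := by
    rw [hh, Real.sq_sqrt (div_nonneg (by linarith) hd1'.le), mul_div_cancel₀ _ hd1'.ne']
  have hnoise : (√g - h) ^ 2 ≤ ε * (2 - ε) :=
    S.sq_sub_le_noise hd hφ he1 heφ (Real.sqrt_nonneg _) (Real.sqrt_nonneg _) hG hh2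
  have hgmax := guess_le_of_sq_sub_le (Real.sqrt_nonneg _) hG
    (by nlinarith [sq_nonneg h]) (by nlinarith) hnoise
  have hN := noisyRealizes_of_sq_add_eq hd he he1 hφ heφ (G := √g) (h := h)
    (p := 1 - S.p none) (by linarith [S.guess_nonneg (e := e)]) (by linarith) (by linarith)
  set c := (√g - h) ^ 2 / 2 with hc
  have hc0 : 0 ≤ c := by positivity
  have hcε : c ≤ ε - ε ^ 2 / 2 := by linarith
  have hε2 : 0 < ε ^ 2 := by positivity
  have hc1 : 0 < 1 - c := by linarith
  -- The weight of the trivial ensemble that brings the total noise from `c` to `ε`. The error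
  -- becomes `1 - q` times the old one, and the guess grows by `q * (1 - g)`.
  set q := (ε - c) / (1 - c) with hq
  have hq0 : ε ^ 2 / 2 ≤ q := by
    rw [hq, le_div_iff₀ hc1]
    nlinarith
  have hq1 : q ≤ 1 := (div_le_one hc1).2 (by linarith)
  have hm := hN.mix he hφ (noisyRealizes_trivial hd he he1 hφ) (q := q) (by linarith) hq1
  have hqε : (1 - q) * c + q * 1 = ε := by
    rw [hq]
    field_simp
    ring
  rw [hqε, hG] at hm
  obtain ⟨J, hJi, hJg⟩ := hm.exists_jointStrategy (by lia) he hφ heφ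
  refine ⟨J, ?_, ?_⟩
  · rw [JointStrategy.error, SingleStrategy.error, hJi, hJg, SingleStrategy.inconclusive, ← hg]
    nlinarith
  · rw [hJg]
    nlinarith [sq_nonneg ((1 - √(ε * (2 - ε))) / 2)]

lemma isState_depolarize_ketbra (hd : 0 < d) (hφ : ‖φ‖ = 1) {δ : ℝ} (hδ0 : 0 ≤ δ) (hδ1 : δ ≤ 1) :
    IsState (depolarize δ (ketbra φ)) := by
  have hd0 : (d : ℂ) ≠ 0 := by
    have : d ≠ 0 := by lia
    exact_mod_cast this
  rw [depolarize_ketbra _ hφ]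
  refine ⟨((ketbra_posSemidef φ).smul (by linarith : 0 ≤ 1 - δ)).add
    (Matrix.PosSemidef.one.smul (by positivity)), ?_⟩
  rw [Matrix.trace_add, Matrix.trace_smul, Matrix.trace_smul, trace_ketbra, hφ, Matrix.trace_one]
  simp only [Complex.real_smul, Fintype.card_fin]
  push_cast
  field_simp
  ring

/-- Always answering inconclusively is admissible for every `T ≥ 0`; the supremum is therefore over
a nonempty set, as `csSup_le` demands. -/
lemma nonempty_singleStrategy {ρ : Matrix (Fin d) (Fin d) ℂ} (hρ : IsState ρ)
    (M : Fin d → Matrix (Fin d) (Fin d) ℂ) : ∃ S : SingleStrategy ρ, S.error M = 0 :=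
  ⟨{  p := fun μ => if μ = none then 1 else 0
      σ := fun _ => ρ
      p_nonneg := fun μ => by split_ifs <;> norm_num
      p_sum := by simp
      isState := fun _ => hρ
      state_eq := by simp }, by
    simp [SingleStrategy.error, SingleStrategy.inconclusive, SingleStrategy.guess]⟩

/-- Rephasing the basis `m` makes the unbiased vector `φ` a multiple of the sum of the basis. -/
lemma IsUnbiased.exists_rephasing (hd : 0 < d)
    {m : OrthonormalBasis (Fin d) ℂ (EuclideanSpace ℂ (Fin d))} (h : IsUnbiased m φ) :
    ∃ e : Fin d → EuclideanSpace ℂ (Fin d), Orthonormal ℂ e ∧ (∀ x, ketbra (e x) = ketbra (m x)) ∧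
      ∑ x, e x = √(d : ℝ) • φ := by
  have hd0 : (0 : ℝ) < d := by exact_mod_cast hd
  -- Unbiasedness makes the rescaled coefficients of `φ` pure phases, which can be absorbed into the
  -- basis without changing its projectors.
  have hω : ∀ x, ‖√(d : ℝ) • inner ℂ (m x) φ‖ = 1 := fun x => by
    rw [← pow_eq_one_iff_of_nonneg (norm_nonneg _) two_ne_zero, norm_smul, mul_pow, h x,
      Real.norm_eq_abs, sq_abs, Real.sq_sqrt hd0.le, mul_one_div_cancel hd0.ne']
  refine ⟨fun x => (√(d : ℝ) • inner ℂ (m x) φ) • m x, ⟨fun x => ?_, fun x y hxy => ?_⟩,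
    fun x => ketbra_smul_of_norm_eq_one (hω x) _, ?_⟩
  · rw [norm_smul, hω, m.norm_eq_one, one_mul]
  · dsimp only
    rw [inner_smul_left, inner_smul_right, m.orthonormal.2 hxy, mul_zero, mul_zero]
  · simp only [smul_assoc, ← Finset.smul_sum]
    rw [m.sum_repr']

end SharedNoise

theorem theorem6 {d : ℕ} (hd : 2 ≤ d)
    (m : OrthonormalBasis (Fin d) ℂ (EuclideanSpace ℂ (Fin d)))
    (φ : EuclideanSpace ℂ (Fin d)) (hφ : ‖φ‖ = 1) (hmφ : SharedNoise.IsUnbiased m φ)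
    (ε δ : ℝ) (hε0 : 0 < ε) (hε1 : ε < 1) (hδ : δ = ε * (2 - ε)) :
    (∀ T : ℝ, 0 ≤ T →
      SharedNoise.singleGuessProb
          (SharedNoise.depolarize δ (SharedNoise.ketbra φ))
          (SharedNoise.basisMeasurement m) T <
        SharedNoise.jointGuessProb
          (SharedNoise.depolarize ε (SharedNoise.ketbra φ))
          (fun x => SharedNoise.depolarize ε (SharedNoise.basisMeasurement m x)) T) ∧
    (SharedNoise.critNoise d ≤ ε → ∀ T : ℝ, 0 ≤ T →
      IsGreatest
        (SharedNoise.jointGuesses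
          (SharedNoise.depolarize ε (SharedNoise.ketbra φ))
          (fun x => SharedNoise.depolarize ε (SharedNoise.basisMeasurement m x)) T) 1) := by
  open SharedNoise in
  have hd0 : 0 < d := by lia
  obtain ⟨e, he, hem, heφ⟩ := hmφ.exists_rephasing hd0
  have he1 : ∑ x, ketbra (e x) = 1 := by
    simp only [hem]
    exact sum_ketbra_orthonormalBasis m
  have hM : basisMeasurement m = fun x => ketbra (e x) := funext fun x => (hem x).symm
  have hbdd : ∀ T, 1 ∈ upperBounds (jointGuesses (depolarize ε (ketbra φ))
      (fun x => depolarize ε (ketbra (e x))) T) := by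
    rintro T _ ⟨S, -, rfl⟩
    exact S.guess_le_one
  have hδ1 : ε * (2 - ε) < 1 := by nlinarith [sq_pos_of_pos (sub_pos.2 hε1)]
  rw [hM, hδ]
  refine ⟨fun T hT => ?_, fun hε T hT => ⟨?_, hbdd T⟩⟩
  · have hgap : 0 < ε ^ 2 / 2 * ((1 - √(ε * (2 - ε))) / 2) ^ 2 := by
      have : √(ε * (2 - ε)) < 1 := by rw [Real.sqrt_lt' one_pos]; simpa using hδ1
      have : 0 < 1 - √(ε * (2 - ε)) := by linarith
      positivity
    -- The gap does not depend on the strategy, so it passes to the suprema and the inequality stays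
    -- strict.
    refine lt_of_le_of_lt (csSup_le ?_ ?_) (sub_lt_self _ hgap)
    · obtain ⟨S, hS⟩ := nonempty_singleStrategy (isState_depolarize_ketbra hd0 hφ
        (mul_nonneg hε0.le (by linarith)) hδ1.le) (fun x => ketbra (e x))
      exact ⟨_, S, hS.trans_le hT, rfl⟩
    · rintro _ ⟨S, hS, rfl⟩
      obtain ⟨J, hJ, hJg⟩ := S.exists_jointStrategy hd he he1 hφ heφ hε0 hε1
      rw [le_sub_iff_add_le]
      exact hJg.trans (le_csSup ⟨1, hbdd T⟩ ⟨J, hJ.trans hS, rfl⟩)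
  · obtain ⟨S, hSi, hSg⟩ := (noisyRealizes_of_critNoise_le hd he he1 hφ heφ hε
      hε1.le).exists_jointStrategy hd0 he hφ heφ
    refine ⟨S, ?_, hSg⟩
    rw [JointStrategy.error, hSi, hSg]
    linarith
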